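/- Let $\mathbb{K}$ be a field of characteristic zero and let $m\ge 1$, $n$, $r$ be integers with $n\le 5$ and $2<r<n$. Let $E$ be the edge set of the complete bipartite graph $K_{m,n}$, and let $M=M_{K_{m,n}}^{r}$ be the truncation to rank $r$ of the graphic matroid of $K_{m,n}$: its ground set is $E$ and its bases are the $r$-element subsets of edge sets of spanning trees of $K_{m,n}$ (equivalently, the $r$-edge forests in $K_{m,n}$). Let $$\Phi_M=\sum_{B}\prod_{e\in B}x_e\in\mathbb{K}[x_e\mid e\in E],$$ where $B$ runs over the bases of $M$, let $$\mathrm{Ann}(\Phi_M)=\{P\in\mathbb{K}[x_e\mid e\in E] : P(\partial/\partial x_e : e\in E)\,\Phi_M=0\},$$ and let $A_M=\mathbb{K}[x_e\mid e\in E]/\mathrm{Ann}(\Phi_M)$, with $A_k\subseteq A_M$ the space of classes of homogeneous polynomials of degree $k$. Then $A_M=\bigoplus_{k=0}^{r}A_k$ is a graded Artinian algebra with $A_r\neq 0$, and it has the strong Lefschetz property: there is an element $L\in A_1$ such that the multiplication map $\times L^{r-2k}\colon A_k\to A_{r-k}$ is bijective for all integers $0\le k\le r/2$ (such an $L$ is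 called a strong Lefschetz element). Moreover, $L=\sum_{e\in E}x_e$ is a strong Lefschetz element. -/

import Mathlib

open scoped IsMulCommutative in
/-- `P ↦ P(∂/∂x₁, …, ∂/∂x_N)`: the algebra homomorphism that sends the variable `x_i` to the
operator `∂/∂x_i` on polynomials.  It takes values in the algebra generated by the partial
derivatives, which is commutative. -/
noncomputable def diffOp (σ K : Type*) [Field K] :
    MvPolynomial σ K →ₐ[K] Module.End K (MvPolynomial σ K) :=
  let S : Set (Module.End K (MvPolynomial σ K)) :=
    Set.range fun i : σ => (MvPolynomial.pderiv (R := K) i).toLinearMap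
  have hS : ∀ a ∈ S, ∀ b ∈ S, a * b = b * a := by
    rintro _ ⟨i, rfl⟩ _ ⟨j, rfl⟩
    have h : ⁅(MvPolynomial.pderiv i : Derivation K (MvPolynomial σ K) (MvPolynomial σ K)),
        (MvPolynomial.pderiv j : Derivation K (MvPolynomial σ K) (MvPolynomial σ K))⁆ = 0 := by
      classical
      refine MvPolynomial.derivation_ext fun k => ?_
      simp [Derivation.commutator_apply, MvPolynomial.pderiv_X, Pi.single_apply, apply_ite]
    refine LinearMap.ext fun p => ?_
    have hp := congrArg (fun D => D p) h
    simpa [Derivation.commutator_apply, sub_eq_zero] using hp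
  haveI := Algebra.isMulCommutative_adjoin K hS
  (Algebra.adjoin K S).val.comp
    (MvPolynomial.aeval fun i : σ => (⟨(MvPolynomial.pderiv (R := K) i).toLinearMap,
      Algebra.subset_adjoin ⟨i, rfl⟩⟩ : Algebra.adjoin K S))

theorem diffOp_X {σ K : Type*} [Field K] (i : σ) (f : MvPolynomial σ K) :
    diffOp σ K (MvPolynomial.X i) f = MvPolynomial.pderiv i f := by
  simp [diffOp]

/-- `Ann(Φ) = {P | P(∂/∂x₁, …, ∂/∂x_N) Φ = 0}`. -/
noncomputable def annIdeal {σ K : Type*} [Field K] (Φ : MvPolynomial σ K) :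
    Ideal (MvPolynomial σ K) where
  carrier := {P | diffOp σ K P Φ = 0}
  add_mem' {P Q} hP hQ := by
    change diffOp σ K P Φ = 0 at hP
    change diffOp σ K Q Φ = 0 at hQ
    change diffOp σ K (P + Q) Φ = 0
    rw [map_add, LinearMap.add_apply, hP, hQ, add_zero]
  zero_mem' := by simp
  smul_mem' P Q hQ := by
    change diffOp σ K Q Φ = 0 at hQ
    change diffOp σ K (P • Q) Φ = 0
    rw [smul_eq_mul, map_mul, Module.End.mul_apply, hQ, map_zero]

/-- The algebra `K[x₁, …, x_N] / Ann(Φ)`. -/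
abbrev AnnQuotient {σ K : Type*} [Field K] (Φ : MvPolynomial σ K) : Type _ :=
  MvPolynomial σ K ⧸ annIdeal Φ

/-- The homogeneous space `A_k` of `A = K[x₁, …, x_N] / Ann(Φ)`: the classes of the homogeneous
polynomials of degree `k`. -/
noncomputable def annQuotientPiece {σ K : Type*} [Field K] (Φ : MvPolynomial σ K) (k : ℕ) :
    Submodule K (AnnQuotient Φ) :=
  (MvPolynomial.homogeneousSubmodule σ K k).map
    (Ideal.Quotient.mkₐ K (annIdeal Φ)).toLinearMap

/-- `A = ⨁_{k=0}^{s} A_k` is a graded Artinian algebra with `A_s ≠ 0`. -/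
structure IsGradedArtinian {K A : Type*} [Field K] [CommRing A] [Algebra K A]
    (𝒜 : ℕ → Submodule K A) (s : ℕ) : Prop where
  gradedMonoid : SetLike.GradedMonoid 𝒜
  isInternal : DirectSum.IsInternal 𝒜
  isArtinianRing : IsArtinianRing A
  top_ne_bot : 𝒜 s ≠ ⊥
  eq_bot_of_lt : ∀ k, s < k → 𝒜 k = ⊥

/-- `L ∈ A₁` is a strong Lefschetz element of `A = ⨁_{k=0}^{s} A_k`: multiplication by
`L ^ (s - 2 * k)` is a bijection `A_k → A_{s-k}` for all `k ≤ s / 2`. -/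
def IsStrongLefschetzElement {K A : Type*} [Field K] [CommRing A] [Algebra K A]
    (𝒜 : ℕ → Submodule K A) (s : ℕ) (L : A) : Prop :=
  L ∈ 𝒜 1 ∧ ∀ k : ℕ, 2 * k ≤ s →
    Set.BijOn (fun a => L ^ (s - 2 * k) * a) (𝒜 k : Set A) (𝒜 (s - k) : Set A)

/-- The strong Lefschetz property of a graded Artinian algebra `A = ⨁_{k=0}^{s} A_k`,
`A_s ≠ 0`. -/
def HasStrongLefschetzProperty {K A : Type*} [Field K] [CommRing A] [Algebra K A]
    (𝒜 : ℕ → Submodule K A) (s : ℕ) : Prop :=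
  IsGradedArtinian 𝒜 s ∧ ∃ L : A, IsStrongLefschetzElement 𝒜 s L

open Classical in
/-- The basis generating function `Φ_M = ∑_B ∏_{b ∈ B} x_b` of a finite matroid, in variables
indexed by the ground set. -/
noncomputable def basisGeneratingFunction (K : Type*) [Field K] {α : Type*} [Finite α]
    (M : Matroid α) : MvPolynomial M.E K :=
  letI := Fintype.ofFinite M.E
  ∑ B : Finset M.E with M.IsBase (Subtype.val '' (B : Set M.E)), ∏ b ∈ B, MvPolynomial.X b

/-- The sum of all the variables, as an element of `A_M = K[x_e | e ∈ E] / Ann(Φ_M)`. -/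
noncomputable def sumOfVariables (K : Type*) [Field K] {α : Type*} [Finite α]
    (M : Matroid α) : AnnQuotient (basisGeneratingFunction K M) :=
  letI := Fintype.ofFinite M.E
  ∑ e : M.E, Ideal.Quotient.mk (annIdeal (basisGeneratingFunction K M)) (MvPolynomial.X e)

/-- The graphic matroid of a finite graph: the ground set is the set of edges, and a set of edges
is independent if it is the edge set of a forest. -/
noncomputable def graphicMatroid {V : Type*} [Finite V] (G : SimpleGraph V) : Matroid (Sym2 V) :=
  (IndepMatroid.ofBdd (E := G.edgeSet)
    (Indep := fun I => I ⊆ G.edgeSet ∧ (SimpleGraph.fromEdgeSet I).IsAcyclic)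
    (indep_empty := by simp)
    (indep_subset := fun I J hJ hIJ => ⟨hIJ.trans hJ.1,
      hJ.2.anti (SimpleGraph.fromEdgeSet_mono hIJ)⟩)
    (indep_aug := by
      intro I B hI hImax hB
      by_contra! hcon
      apply hImax
      have hle : ∀ u v, (SimpleGraph.fromEdgeSet B).Adj u v →
          (SimpleGraph.fromEdgeSet I).Reachable u v := by
        intro u v huv
        by_contra hn
        have hmem : s(u, v) ∈ B := ((SimpleGraph.fromEdgeSet_adj B).1 huv).1
        have hnot : s(u, v) ∉ I := fun h =>
          hn (SimpleGraph.Adj.reachable ((SimpleGraph.fromEdgeSet_adj I).2 ⟨h, huv.ne⟩))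
        refine hcon _ ⟨hmem, hnot⟩ (Set.insert_subset (hB.prop.1 hmem) hI.1) ?_
        have h := hI.2.sup_edge_of_not_reachable hn
        rwa [SimpleGraph.edge, ← SimpleGraph.fromEdgeSet_union, Set.union_comm,
          Set.singleton_union] at h
      refine ⟨hI, fun J hJ hIJ e heJ => ?_⟩
      by_contra heI
      induction e with | h u v => ?_
      have hne : u ≠ v := (hJ.1 heJ : G.Adj u v).ne
      have hJI : (SimpleGraph.fromEdgeSet I ⊔ SimpleGraph.edge u v).IsAcyclic := by
        refine hJ.2.anti (sup_le (SimpleGraph.fromEdgeSet_mono hIJ) ?_)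
        exact SimpleGraph.fromEdgeSet_mono (Set.singleton_subset_iff.2 heJ)
      have hIn : ¬ (SimpleGraph.fromEdgeSet I).Reachable u v := fun h => by
        rcases (SimpleGraph.isAcyclic_sup_fromEdgeSet_iff.1 hJI).2 h with h | h
        · exact hne h
        · exact heI ((SimpleGraph.fromEdgeSet_adj I).1 h).1
      have htrans : ∀ u v, (SimpleGraph.fromEdgeSet B).Reachable u v →
          (SimpleGraph.fromEdgeSet I).Reachable u v := by
        rintro u v ⟨p⟩
        induction p with
        | nil => exact SimpleGraph.Reachable.refl _
        | cons h _ ih => exact (hle _ _ h).trans ih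
      have hBn : ¬ (SimpleGraph.fromEdgeSet B).Reachable u v := fun h => hIn (htrans u v h)
      have heB : s(u, v) ∉ B := fun h =>
        hBn (SimpleGraph.Adj.reachable ((SimpleGraph.fromEdgeSet_adj B).2 ⟨h, hne⟩))
      refine heB (hB.le_of_ge ⟨Set.insert_subset (hJ.1 heJ) hB.prop.1, ?_⟩
        (Set.subset_insert s(u, v) B) (Set.mem_insert _ _))
      have h := hB.prop.2.sup_edge_of_not_reachable hBn
      rwa [SimpleGraph.edge, ← SimpleGraph.fromEdgeSet_union, Set.union_comm,
        Set.singleton_union] at h)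
    (subset_ground := fun _ hI => hI.1)
    (indep_bdd := ⟨Nat.card (Sym2 V), fun I _ => by
      rw [← (Set.toFinite I).cast_ncard_eq]
      exact_mod_cast Set.ncard_le_card I⟩)).matroid

/-- The bases of the graphic matroid of a connected graph are the spanning trees. -/
theorem graphicMatroid_isBase_iff {V : Type*} [Finite V] {G : SimpleGraph V} (hG : G.Connected)
    (B : Set (Sym2 V)) :
    (graphicMatroid G).IsBase B ↔ B ⊆ G.edgeSet ∧ (SimpleGraph.fromEdgeSet B).IsTree := by
  have key : ∀ {B : Set (Sym2 V)}, B ⊆ G.edgeSet → (SimpleGraph.fromEdgeSet B).edgeSet = B := by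
    intro B h
    rw [SimpleGraph.edgeSet_fromEdgeSet]
    refine sdiff_eq_left.2 (Set.disjoint_left.2 fun e he hd => ?_)
    exact G.not_isDiag_of_mem_edgeSet (h he) hd
  have hsub : ∀ {B : Set (Sym2 V)}, B ⊆ G.edgeSet → SimpleGraph.fromEdgeSet B ≤ G := by
    intro B h
    rw [← SimpleGraph.edgeSet_subset_edgeSet, key h]
    exact h
  change Maximal (fun I => I ⊆ G.edgeSet ∧ (SimpleGraph.fromEdgeSet I).IsAcyclic) B ↔ _
  constructor
  · intro h
    refine ⟨h.prop.1, (hG.maximal_le_isAcyclic_iff_isTree (hsub h.prop.1)).1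
      ⟨⟨hsub h.prop.1, h.prop.2⟩, fun H hH hle => ?_⟩⟩
    have hB : B ⊆ H.edgeSet := by
      rw [← key h.prop.1]
      exact SimpleGraph.edgeSet_subset_edgeSet.2 hle
    have := h.le_of_ge (y := H.edgeSet)
      ⟨SimpleGraph.edgeSet_subset_edgeSet.2 hH.1, by simpa using hH.2⟩ hB
    simpa using SimpleGraph.fromEdgeSet_mono this
  · rintro ⟨h1, h2⟩
    have hm := (hG.maximal_le_isAcyclic_iff_isTree (hsub h1)).2 h2
    refine ⟨⟨h1, h2.isAcyclic⟩, fun J hJ hle => ?_⟩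
    have h := hm.le_of_ge ⟨hsub hJ.1, hJ.2⟩ (SimpleGraph.fromEdgeSet_mono hle)
    rw [← SimpleGraph.edgeSet_subset_edgeSet, key h1, key hJ.1] at h
    exact h

/-- The truncation of a matroid to rank `r`: the independent sets are those of `M` with at most
`r` elements. -/
noncomputable def truncatedMatroid {α : Type*} (M : Matroid α) (r : ℕ) : Matroid α :=
  (IndepMatroid.ofBddAugment (E := M.E)
    (Indep := fun I => M.Indep I ∧ I.encard ≤ r)
    (indep_empty := by simp)
    (indep_subset := fun I J hJ hIJ =>
      ⟨hJ.1.subset hIJ, (Set.encard_le_encard hIJ).trans hJ.2⟩)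
    (indep_aug := fun I J hI hJ hlt => by
      obtain ⟨e, he, hind⟩ := hI.1.augment hJ.1 hlt
      refine ⟨e, he.1, he.2, hind, ?_⟩
      rw [Set.encard_insert_of_notMem he.2]
      exact (Order.add_one_le_of_lt hlt).trans hJ.2)
    (indep_bdd := ⟨r, fun _ hI => hI.2⟩)
    (subset_ground := fun _ hI => hI.1.subset_ground)).matroid

/-- If `r` is at most the rank of `M`, then the bases of the truncation are the `r`-element subsets
of the bases of `M`. -/
theorem truncatedMatroid_isBase_iff {α : Type*} {M : Matroid α} {r : ℕ} (hr : (r : ℕ∞) ≤ M.eRank)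
    (B' : Set α) :
    (truncatedMatroid M r).IsBase B' ↔ B'.encard = r ∧ ∃ B, M.IsBase B ∧ B' ⊆ B := by
  change Maximal (fun I => M.Indep I ∧ I.encard ≤ r) B' ↔ _
  constructor
  · intro h
    refine ⟨le_antisymm h.prop.2 (not_lt.1 fun hlt => ?_), h.prop.1.exists_isBase_superset⟩
    obtain ⟨B, hB⟩ := M.exists_isBase
    obtain ⟨e, he, hind⟩ := h.prop.1.augment hB.indep
      (lt_of_lt_of_le hlt (hr.trans_eq hB.encard_eq_eRank.symm))
    refine he.2 (h.le_of_ge ⟨hind, ?_⟩ (Set.subset_insert e B') (Set.mem_insert _ _))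
    rw [Set.encard_insert_of_notMem he.2]
    exact Order.add_one_le_of_lt hlt
  · rintro ⟨h1, B, hB, hsub⟩
    refine ⟨⟨hB.indep.subset hsub, h1.le⟩, fun J hJ hle => ?_⟩
    have hfin : J.Finite := Set.finite_of_encard_le_coe hJ.2
    exact (hfin.eq_of_subset_of_encard_le' hle (h1 ▸ hJ.2)).ge

/-- The truncation to rank `r` of the graphic matroid of the complete bipartite graph `K_{m,n}`. -/
noncomputable abbrev truncatedKmn (m n r : ℕ) : Matroid (Sym2 (Fin m ⊕ Fin n)) :=
  truncatedMatroid (graphicMatroid (completeBipartiteGraph (Fin m) (Fin n))) r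

/-! `Φ` is homogeneous of degree `r`, so `A_M` satisfies Poincaré duality: `A_k` and `A_{r-k}` pair
nondegenerately into `A_r`, and injectivity of each Lefschetz map is enough
(`bijOn_pow_mul_of_injective`). The bounds leave only `r = 3`, or `r = 4` with `n = 5`, so the only
degrees to treat are `k = 0`, `k = 1` and the trivial middle degree.

Euler's identity at `(1, …, 1)` turns `L^d(∂)F` into `d! · F(1, …, 1)` for `F` homogeneous of degree
`d`. For `k = 0` this gives `r!` times the number of bases. For `k = 1` it reduces injectivity to
nondegeneracy of the Hessian of `Φ` at `(1, …, 1)` (`isStrongLefschetzElement_squarefreeSum`).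

Edges of `K_{m,n}` are cells of an `m × n` grid, and a set of at most four edges is a forest iff it
contains no rectangle (`isAcyclic_bipartiteEdge_iff`). For `r = 3` every triple is a basis and the
Hessian is a multiple of `J - I`, where `J` is the all-ones matrix. For `r = 4` the rectangles are
subtracted; the resulting matrix is invariant under row and column permutations, and its kernel is
computed from the total, the row sums, the column sums and the entries in turn
(`eq_zero_of_rectangleFree_four_hessian`). -/

namespace MvPolynomial

/-! ### Differential operators on homogeneous polynomials -/

variable {σ K : Type*} [Field K]

theorem diffOp_mul_apply (P Q F : MvPolynomial σ K) :
    diffOp σ K (P * Q) F = diffOp σ K P (diffOp σ K Q F) := by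
  rw [map_mul, Module.End.mul_apply]

theorem diffOp_C_apply (c : K) (F : MvPolynomial σ K) : diffOp σ K (C c) F = c • F := by
  rw [← algebraMap_eq, AlgHom.commutes, Module.algebraMap_end_apply]

theorem IsHomogeneous.exists_eq_C {F : MvPolynomial σ K} (hF : F.IsHomogeneous 0) :
    ∃ c, F = C c := by
  have := (mem_homogeneousSubmodule 0 F).2 hF
  rw [homogeneousSubmodule_zero, Submodule.mem_one] at this
  obtain ⟨c, hc⟩ := this
  exact ⟨c, hc.symm⟩

theorem homogeneousSubmodule_succ_eq (j : ℕ) :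
    homogeneousSubmodule σ K (j + 1) =
      Submodule.span K (Set.range X) * homogeneousSubmodule σ K j := by
  rw [← homogeneousSubmodule_one_eq_span_X,
    ← homogeneousSubmodule_one_pow (σ := σ) (R := K) (j + 1),
    ← homogeneousSubmodule_one_pow (σ := σ) (R := K) j, pow_succ']

/-- A homogeneous polynomial of degree `j + 1` is a sum of products of a variable and a
homogeneous polynomial of degree `j`. -/
theorem homogeneous_succ_induction {j : ℕ} {p : MvPolynomial σ K → Prop}
    (hmul : ∀ i (Q : MvPolynomial σ K), Q.IsHomogeneous j → p (X i * Q))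
    (hadd : ∀ P Q, p P → p Q → p (P + Q)) (hzero : p 0)
    (hsmul : ∀ (c : K) P, p P → p (c • P)) {P : MvPolynomial σ K}
    (hP : P.IsHomogeneous (j + 1)) : p P := by
  have hP' := (mem_homogeneousSubmodule _ P).2 hP
  rw [homogeneousSubmodule_succ_eq] at hP'
  refine Submodule.mul_induction_on hP' (fun L hL Q hQ => ?_) hadd
  refine Submodule.span_induction (p := fun L _ => p (L * Q)) ?_ ?_ ?_ ?_ hL
  · rintro _ ⟨i, rfl⟩
    exact hmul i Q hQ
  · simpa using hzero
  · intro x y _ _ hx hy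
    rw [add_mul]
    exact hadd _ _ hx hy
  · intro c x _ hx
    rw [smul_mul_assoc]
    exact hsmul c _ hx

theorem IsHomogeneous.diffOp {j n : ℕ} {P F : MvPolynomial σ K} (hP : P.IsHomogeneous j)
    (hF : F.IsHomogeneous n) : (diffOp σ K P F).IsHomogeneous (n - j) := by
  induction j generalizing P with
  | zero =>
    obtain ⟨c, rfl⟩ := hP.exists_eq_C
    rw [diffOp_C_apply]
    exact (homogeneousSubmodule σ K n).smul_mem c hF
  | succ j ih =>
    refine homogeneous_succ_induction (p := fun P => (_root_.diffOp σ K P F).IsHomogeneous _)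
      (fun i Q hQ => ?_) (fun P Q hP hQ => ?_) ?_ (fun c P hP => ?_) hP
    · rw [diffOp_mul_apply, diffOp_X, ← Nat.sub_sub]
      exact (ih hQ).pderiv
    · rw [map_add]
      exact hP.add hQ
    · rw [map_zero]
      exact isHomogeneous_zero _ _ _
    · rw [map_smul]
      exact (homogeneousSubmodule σ K _).smul_mem c hP

theorem IsHomogeneous.diffOp_eq_zero {j n : ℕ} {P F : MvPolynomial σ K} (hP : P.IsHomogeneous j)
    (hF : F.IsHomogeneous n) (hnj : n < j) : _root_.diffOp σ K P F = 0 := by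
  obtain ⟨j, rfl⟩ := Nat.exists_eq_succ_of_ne_zero (Nat.ne_zero_of_lt hnj)
  refine homogeneous_succ_induction (p := fun P => _root_.diffOp σ K P F = 0)
      (fun i Q hQ => ?_) (fun P Q hP hQ => ?_) ?_ (fun c P hP => ?_) hP
  -- `Q` already has degree at least `n`, so `Q(∂)F` is constant and one more derivative kills it.
  · have h := hQ.diffOp hF
    rw [Nat.sub_eq_zero_of_le (Nat.lt_succ_iff.1 hnj)] at h
    obtain ⟨c, hc⟩ := h.exists_eq_C
    rw [diffOp_mul_apply, diffOp_X, hc, pderiv_C]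
  · rw [map_add, LinearMap.add_apply, hP, hQ, add_zero]
  · rw [map_zero, LinearMap.zero_apply]
  · rw [map_smul, LinearMap.smul_apply, hP, smul_zero]

/-- By induction all partial derivatives vanish; Euler's identity then gives `d • G = 0`, and
characteristic zero finishes. -/
theorem IsHomogeneous.eq_zero_of_diffOp [CharZero K] [Fintype σ] {d : ℕ} {G : MvPolynomial σ K}
    (hG : G.IsHomogeneous d)
    (h : ∀ Q : MvPolynomial σ K, Q.IsHomogeneous d → _root_.diffOp σ K Q G = 0) : G = 0 := by
  induction d generalizing G with
  | zero => simpa using h 1 (isHomogeneous_one σ K)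
  | succ d ih =>
    have hi : ∀ i, pderiv i G = 0 := fun i => by
      refine ih (by simpa using hG.pderiv (i := i)) fun Q hQ => ?_
      rw [← diffOp_X, ← diffOp_mul_apply]
      exact h _ (hQ.mul (isHomogeneous_X K i))
    have hE := hG.sum_X_mul_pderiv
    simp only [hi, mul_zero, Finset.sum_const_zero] at hE
    exact (smul_eq_zero.1 hE.symm).resolve_left (Nat.succ_ne_zero d)

theorem isHomogeneous_sum_X [Fintype σ] : (∑ i, X i : MvPolynomial σ K).IsHomogeneous 1 :=
  IsHomogeneous.sum _ _ _ fun i _ => isHomogeneous_X K i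

/-- Euler's identity `∑ x_i ∂_i F = d F` with every `x_i` set to `1`. -/
theorem IsHomogeneous.eval_one_diffOp_sum_X [Fintype σ] {d : ℕ} {F : MvPolynomial σ K}
    (hF : F.IsHomogeneous d) :
    eval (fun _ => 1) (_root_.diffOp σ K (∑ i, X i) F) = d * eval (fun _ => 1) F := by
  have h := congrArg (eval fun _ => (1 : K)) hF.sum_X_mul_pderiv
  simp only [map_sum, map_mul, eval_X, one_mul, nsmul_eq_mul, map_natCast] at h
  rw [map_sum, LinearMap.sum_apply, map_sum, ← h]
  simp_rw [diffOp_X]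

theorem IsHomogeneous.eval_one_diffOp_sum_X_pow [Fintype σ] {d : ℕ} {F : MvPolynomial σ K}
    (hF : F.IsHomogeneous d) :
    eval (fun _ => 1) (_root_.diffOp σ K ((∑ i, X i) ^ d) F) =
      d.factorial * eval (fun _ => 1) F := by
  induction d generalizing F with
  | zero => simp
  | succ d ih =>
    have h := ih (F := _root_.diffOp σ K (∑ i, X i) F)
      (by simpa using isHomogeneous_sum_X.diffOp hF)
    rw [pow_succ, diffOp_mul_apply, h, hF.eval_one_diffOp_sum_X, Nat.factorial_succ]
    push_cast
    ring

end MvPolynomial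

open MvPolynomial

/-! ### Grading and Poincaré duality of `K[x] / Ann(Φ)` -/

section AnnQuotient

variable {σ K : Type*} [Field K] {Φ : MvPolynomial σ K}

theorem mem_annIdeal {P : MvPolynomial σ K} : P ∈ annIdeal Φ ↔ diffOp σ K P Φ = 0 :=
  Iff.rfl

theorem mem_annQuotientPiece {k : ℕ} {a : AnnQuotient Φ} :
    a ∈ annQuotientPiece Φ k ↔
      ∃ P : MvPolynomial σ K, P.IsHomogeneous k ∧ Ideal.Quotient.mk (annIdeal Φ) P = a :=
  Iff.rfl

theorem mk_eq_zero_iff_diffOp {P : MvPolynomial σ K} :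
    Ideal.Quotient.mk (annIdeal Φ) P = 0 ↔ diffOp σ K P Φ = 0 := by
  rw [Ideal.Quotient.eq_zero_iff_mem, mem_annIdeal]

/-- The components of `P` of degree at most `s` send `Φ` to distinct degrees, so no cancellation
between them is possible. -/
theorem homogeneousComponent_mem_annIdeal {s : ℕ} (hΦ : Φ.IsHomogeneous s)
    {P : MvPolynomial σ K} (hP : P ∈ annIdeal Φ) (k : ℕ) :
    homogeneousComponent k P ∈ annIdeal Φ := by
  rw [mem_annIdeal] at hP ⊢
  have hcomp := fun i => homogeneousComponent_isHomogeneous (R := K) i P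
  -- Truncated subtraction would place every degree above `s` in degree `0`; those components
  -- annihilate `Φ` and are treated apart.
  rcases lt_or_ge s k with hk | hk
  · exact (hcomp k).diffOp_eq_zero hΦ hk
  rw [← sum_homogeneousComponent P, map_sum, LinearMap.sum_apply] at hP
  have h := congrArg (homogeneousComponent (s - k)) hP
  rw [map_sum, map_zero] at h
  by_cases hkP : k ∈ Finset.range (P.totalDegree + 1)
  · rw [Finset.sum_eq_single_of_mem k hkP, homogeneousComponent_of_mem ((hcomp k).diffOp hΦ),
      if_pos rfl] at h
    · exact h
    · intro i _ hik
      rcases lt_or_ge s i with hi | hi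
      · rw [(hcomp i).diffOp_eq_zero hΦ hi, map_zero]
      · rw [homogeneousComponent_of_mem ((hcomp i).diffOp hΦ), if_neg (by omega)]
  · rw [homogeneousComponent_eq_zero _ _ (by simpa [Nat.lt_succ_iff] using hkP), map_zero,
      LinearMap.zero_apply]

instance annQuotientPiece_gradedMonoid : SetLike.GradedMonoid (annQuotientPiece Φ) where
  one_mem := mem_annQuotientPiece.2 ⟨1, isHomogeneous_one σ K, map_one _⟩
  mul_mem := by
    rintro i j _ _ ⟨P, hP, rfl⟩ ⟨Q, hQ, rfl⟩
    exact mem_annQuotientPiece.2 ⟨P * Q, IsHomogeneous.mul hP hQ, map_mul _ _ _⟩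

theorem annQuotientPiece_isInternal {s : ℕ} (hΦ : Φ.IsHomogeneous s) :
    DirectSum.IsInternal (annQuotientPiece Φ) := by
  classical
  refine ⟨(injective_iff_map_eq_zero _).2 fun f hf => ?_, fun a => ?_⟩
  · choose P hP hPf using fun k => mem_annQuotientPiece.1 (f k).2
    rw [DirectSum.coeAddMonoidHom_eq_dfinsuppSum, DFinsupp.sum] at hf
    simp_rw [← hPf, ← map_sum, Ideal.Quotient.eq_zero_iff_mem] at hf
    refine DFinsupp.ext fun k => ?_
    by_cases hk : k ∈ DFinsupp.support f
    · have h := homogeneousComponent_mem_annIdeal hΦ hf k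
      rw [map_sum, Finset.sum_eq_single_of_mem k hk, homogeneousComponent_of_mem (hP k),
        if_pos rfl, ← Ideal.Quotient.eq_zero_iff_mem, hPf] at h
      · exact Subtype.ext h
      · intro i _ hik
        rw [homogeneousComponent_of_mem (hP i), if_neg (Ne.symm hik)]
    · exact DFinsupp.notMem_support_iff.1 hk
  · obtain ⟨P, rfl⟩ := Ideal.Quotient.mk_surjective a
    refine ⟨∑ i ∈ Finset.range (P.totalDegree + 1), DirectSum.of _ i
      ⟨_, mem_annQuotientPiece.2 ⟨_, homogeneousComponent_isHomogeneous i P, rfl⟩⟩, ?_⟩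
    rw [map_sum]
    simp_rw [DirectSum.coeAddMonoidHom_of]
    rw [← map_sum, sum_homogeneousComponent]

theorem annQuotientPiece_eq_bot {s k : ℕ} (hΦ : Φ.IsHomogeneous s) (hk : s < k) :
    annQuotientPiece Φ k = ⊥ := by
  rw [eq_bot_iff]
  rintro _ ⟨P, hP, rfl⟩
  exact mk_eq_zero_iff_diffOp.2 (IsHomogeneous.diffOp_eq_zero hP hΦ hk)

instance annQuotientPiece_finite [Finite σ] (k : ℕ) : Module.Finite K (annQuotientPiece Φ k) :=
  Module.Finite.iff_fg.2 ((homogeneousSubmodule_fg σ K k).map _)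

theorem annQuotient_finite [Finite σ] {s : ℕ} (hΦ : Φ.IsHomogeneous s) :
    Module.Finite K (AnnQuotient Φ) := by
  refine ⟨?_⟩
  rw [← (annQuotientPiece_isInternal hΦ).submodule_iSup_eq_top]
  have h : ⨆ k, annQuotientPiece Φ k = ⨆ k : Fin (s + 1), annQuotientPiece Φ k := by
    refine le_antisymm (iSup_le fun k => ?_) (iSup_le fun k => le_iSup (annQuotientPiece Φ) k)
    rcases lt_or_ge s k with hk | hk
    · rw [annQuotientPiece_eq_bot hΦ hk]
      exact bot_le
    · exact le_iSup (fun k : Fin (s + 1) => annQuotientPiece Φ k) ⟨k, Nat.lt_succ_iff.2 hk⟩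
  rw [h]
  exact Submodule.fg_iSup _ fun k => Module.Finite.iff_fg.1 (annQuotientPiece_finite _)

/-- The constant coefficient of `P(∂) Φ`; on `A_s` it is an isomorphism onto `K`. -/
noncomputable def annQuotientDegree (Φ : MvPolynomial σ K) : AnnQuotient Φ →ₗ[K] K :=
  (((annIdeal Φ).restrictScalars K).liftQ
    ((MvPolynomial.lcoeff K 0).comp ((LinearMap.applyₗ Φ).comp (diffOp σ K).toLinearMap))
    fun P hP => by
      have : diffOp σ K P Φ = 0 := hP
      simp [this]).comp (Submodule.Quotient.restrictScalarsEquiv K (annIdeal Φ)).symm.toLinearMap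

theorem annQuotientDegree_mk (P : MvPolynomial σ K) :
    annQuotientDegree Φ (Ideal.Quotient.mk (annIdeal Φ) P) = coeff 0 (diffOp σ K P Φ) :=
  rfl

theorem eq_zero_of_annQuotientDegree_eq_zero {s : ℕ} (hΦ : Φ.IsHomogeneous s) {a : AnnQuotient Φ}
    (ha : a ∈ annQuotientPiece Φ s) (h : annQuotientDegree Φ a = 0) : a = 0 := by
  obtain ⟨P, hP, rfl⟩ := mem_annQuotientPiece.1 ha
  obtain ⟨c, hc⟩ := (Nat.sub_self s ▸ IsHomogeneous.diffOp hP hΦ :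
    (diffOp σ K P Φ).IsHomogeneous 0).exists_eq_C
  rw [annQuotientDegree_mk, hc, coeff_zero_C] at h
  rw [mk_eq_zero_iff_diffOp, hc, h, C_0]

variable [CharZero K] [Fintype σ]

/-- Nondegeneracy of the pairing `A_k × A_{s-k} → A_s`. -/
theorem annQuotientPiece_eq_zero_of_mul {s k : ℕ} (hΦ : Φ.IsHomogeneous s)
    {a : AnnQuotient Φ} (ha : a ∈ annQuotientPiece Φ k)
    (h : ∀ b ∈ annQuotientPiece Φ (s - k), a * b = 0) : a = 0 := by
  obtain ⟨P, hP, rfl⟩ := ha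
  -- `P(∂)Φ` has degree `s - k` and is killed by every operator of that degree.
  refine mk_eq_zero_iff_diffOp.2 ((IsHomogeneous.diffOp hP hΦ).eq_zero_of_diffOp fun Q hQ => ?_)
  rw [← diffOp_mul_apply, ← mk_eq_zero_iff_diffOp, mul_comm, map_mul]
  exact h _ ⟨Q, hQ, rfl⟩

/-- If `A_s` were zero, nondegeneracy of the pairing with `A_0` would force `1 = 0`, hence `Φ = 0`.
-/
theorem annQuotientPiece_top_ne_bot {s : ℕ} (hΦ : Φ.IsHomogeneous s) (h0 : Φ ≠ 0) :
    annQuotientPiece Φ s ≠ ⊥ := by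
  intro h
  refine h0 ?_
  have h1 : (1 : AnnQuotient Φ) = 0 :=
    annQuotientPiece_eq_zero_of_mul hΦ SetLike.GradedOne.one_mem fun b hb => by
      rw [Nat.sub_zero, h, Submodule.mem_bot] at hb
      rw [hb, mul_zero]
  rw [← map_one (Ideal.Quotient.mk (annIdeal Φ)), mk_eq_zero_iff_diffOp] at h1
  simpa using h1

theorem annQuotient_isGradedArtinian {s : ℕ} (hΦ : Φ.IsHomogeneous s) (h0 : Φ ≠ 0) :
    IsGradedArtinian (annQuotientPiece Φ) s where
  gradedMonoid := inferInstance
  isInternal := annQuotientPiece_isInternal hΦ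
  isArtinianRing := by
    have := annQuotient_finite hΦ
    exact IsArtinianRing.of_finite K _
  top_ne_bot := annQuotientPiece_top_ne_bot hΦ h0
  eq_bot_of_lt _ := annQuotientPiece_eq_bot hΦ

/-- The pairing embeds `A_k` into the dual of `A_{s-k}`. -/
theorem finrank_annQuotientPiece_le {s k : ℕ} (hΦ : Φ.IsHomogeneous s) (hk : k ≤ s) :
    Module.finrank K (annQuotientPiece Φ k) ≤ Module.finrank K (annQuotientPiece Φ (s - k)) := by
  let T : annQuotientPiece Φ k →ₗ[K] Module.Dual K (annQuotientPiece Φ (s - k)) :=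
    ((LinearMap.mul K (AnnQuotient Φ)).compr₂ (annQuotientDegree Φ)).domRestrict₁₂ _ _
  have hT : Function.Injective T := (injective_iff_map_eq_zero _).2 fun a ha => by
    refine Subtype.ext (annQuotientPiece_eq_zero_of_mul hΦ a.2 fun b hb => ?_)
    refine eq_zero_of_annQuotientDegree_eq_zero hΦ ?_ (LinearMap.congr_fun ha ⟨b, hb⟩)
    have := SetLike.GradedMul.mul_mem a.2 hb
    rwa [Nat.add_sub_cancel' hk] at this
  exact (LinearMap.finrank_le_finrank_of_injective hT).trans_eq Subspace.dual_finrank_eq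

theorem finrank_annQuotientPiece_sub {s k : ℕ} (hΦ : Φ.IsHomogeneous s) (hk : k ≤ s) :
    Module.finrank K (annQuotientPiece Φ k) = Module.finrank K (annQuotientPiece Φ (s - k)) := by
  refine le_antisymm (finrank_annQuotientPiece_le hΦ hk) ?_
  have := finrank_annQuotientPiece_le hΦ (Nat.sub_le s k)
  rwa [Nat.sub_sub_self hk] at this

/-- By Poincaré duality, an injective multiplication map `A_k → A_{s-k}` is bijective. -/
theorem bijOn_pow_mul_of_injective {s k : ℕ} (hΦ : Φ.IsHomogeneous s) (hk : 2 * k ≤ s)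
    {L : AnnQuotient Φ} (hL : L ∈ annQuotientPiece Φ 1)
    (hinj : ∀ a ∈ annQuotientPiece Φ k, L ^ (s - 2 * k) * a = 0 → a = 0) :
    Set.BijOn (fun a => L ^ (s - 2 * k) * a) (annQuotientPiece Φ k : Set (AnnQuotient Φ))
      (annQuotientPiece Φ (s - k) : Set (AnnQuotient Φ)) := by
  have hmaps : ∀ a ∈ annQuotientPiece Φ k,
      LinearMap.mulLeft K (L ^ (s - 2 * k)) a ∈ annQuotientPiece Φ (s - k) := fun a ha => by
    have := SetLike.GradedMul.mul_mem (SetLike.pow_mem_graded (s - 2 * k) hL) ha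
    rwa [smul_eq_mul, mul_one, show s - 2 * k + k = s - k by omega] at this
  have hf : Function.Injective ((LinearMap.mulLeft K (L ^ (s - 2 * k))).restrict hmaps) :=
    (injective_iff_map_eq_zero _).2 fun a ha =>
      Subtype.ext (hinj a a.2 (congrArg Subtype.val ha))
  have hs := (LinearMap.injective_iff_surjective_of_finrank_eq_finrank
    (finrank_annQuotientPiece_sub hΦ (by omega : k ≤ s))).1 hf
  refine ⟨hmaps, fun a ha b hb hab => ?_, fun b hb => ?_⟩
  · have := @hf ⟨a, ha⟩ ⟨b, hb⟩ (Subtype.ext hab)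
    exact congrArg Subtype.val this
  · obtain ⟨a, ha⟩ := hs ⟨b, hb⟩
    exact ⟨a, a.2, congrArg Subtype.val ha⟩

end AnnQuotient

/-! ### Reduction of the Lefschetz property to the Hessian at `(1, …, 1)` -/

section SquarefreeSum

variable {σ K : Type*} [Field K]

/-- The squarefree polynomial `∑ B ∈ 𝓑, ∏ b ∈ B, X b` of a family of finite sets. -/
noncomputable def squarefreeSum (K : Type*) [Field K] (𝓑 : Finset (Finset σ)) :
    MvPolynomial σ K :=
  ∑ B ∈ 𝓑, ∏ b ∈ B, X b

theorem isHomogeneous_squarefreeSum {𝓑 : Finset (Finset σ)} {s : ℕ} (h : ∀ B ∈ 𝓑, B.card = s) :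
    (squarefreeSum K 𝓑).IsHomogeneous s := by
  refine IsHomogeneous.sum _ _ _ fun B hB => ?_
  have := IsHomogeneous.prod B (fun b => (X b : MvPolynomial σ K)) (fun _ => 1)
    fun b _ => isHomogeneous_X K b
  simpa [h B hB] using this

theorem eval_one_squarefreeSum (𝓑 : Finset (Finset σ)) :
    eval (fun _ => 1) (squarefreeSum K 𝓑) = (𝓑.card : K) := by
  simp [squarefreeSum]

theorem exists_eq_linear_of_isHomogeneous_one [Fintype σ] {P : MvPolynomial σ K} (hP : P.IsHomogeneous 1) :
    ∃ v : σ → K, P = ∑ e, v e • X e := by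
  have h := (mem_homogeneousSubmodule 1 P).2 hP
  rw [homogeneousSubmodule_one_eq_span_X, Submodule.mem_span_range_iff_exists_fun] at h
  obtain ⟨v, hv⟩ := h
  exact ⟨v, hv.symm⟩

theorem pderiv_prod_X [DecidableEq σ] (e : σ) (B : Finset σ) :
    pderiv e (∏ b ∈ B, X b : MvPolynomial σ K) = if e ∈ B then ∏ b ∈ B.erase e, X b else 0 := by
  split_ifs with h
  · rw [← Finset.mul_prod_erase B _ h, pderiv_mul, pderiv_X_self, one_mul,
      pderiv_eq_zero_of_notMem_vars, mul_zero, add_zero]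
    refine fun hv => ?_
    obtain ⟨b, hb, hbe⟩ := Finset.mem_biUnion.1 (vars_prod _ hv)
    rw [vars_X, Finset.mem_singleton] at hbe
    exact Finset.ne_of_mem_erase hb hbe.symm
  · refine pderiv_eq_zero_of_notMem_vars fun hv => h ?_
    obtain ⟨b, hb, hbe⟩ := Finset.mem_biUnion.1 (vars_prod _ hv)
    rw [vars_X, Finset.mem_singleton] at hbe
    exact hbe ▸ hb

theorem eval_one_pderiv_pderiv_squarefreeSum [DecidableEq σ] (𝓑 : Finset (Finset σ)) (e f : σ) :
    eval (fun _ => 1) (pderiv e (pderiv f (squarefreeSum K 𝓑))) =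
      ∑ B ∈ 𝓑 with f ∈ B, if e ∈ B.erase f then (1 : K) else 0 := by
  rw [squarefreeSum, map_sum, map_sum, map_sum, Finset.sum_filter]
  refine Finset.sum_congr rfl fun B _ => ?_
  rw [pderiv_prod_X]
  split_ifs with hf
  · rw [pderiv_prod_X, if_pos ‹_›]
    simp
  · rw [pderiv_prod_X, if_neg ‹_›, map_zero]
  · simp

/-- This is row `f` of the Hessian at `(1, …, 1)` applied to `v`: for `e ≠ f` the entry counts the
members of `𝓑` containing both, and the diagonal is zero. -/
theorem eval_one_diffOp_linear_pderiv_squarefreeSum [DecidableEq σ] [Fintype σ]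
    (𝓑 : Finset (Finset σ)) (v : σ → K) (f : σ) :
    eval (fun _ => 1) (diffOp σ K (∑ e, v e • X e) (pderiv f (squarefreeSum K 𝓑))) =
      ∑ B ∈ 𝓑 with f ∈ B, ∑ e ∈ B.erase f, v e := by
  simp only [map_sum, map_smul, LinearMap.sum_apply, LinearMap.smul_apply, diffOp_X, smul_eval,
    eval_one_pderiv_pderiv_squarefreeSum, Finset.mul_sum]
  rw [Finset.sum_comm]
  refine Finset.sum_congr rfl fun B _ => ?_
  simp only [mul_ite, mul_one, mul_zero, Finset.sum_ite_mem, Finset.univ_inter]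

variable [CharZero K]

theorem squarefreeSum_ne_zero {𝓑 : Finset (Finset σ)} (h : 𝓑.Nonempty) :
    squarefreeSum K 𝓑 ≠ 0 := fun h0 => by
  have := eval_one_squarefreeSum (K := K) 𝓑
  rw [h0, map_zero] at this
  exact h.card_ne_zero (by exact_mod_cast this.symm)

/-- For a family of sets of size at most four, the sum of the variables is a strong Lefschetz
element as soon as the Hessian matrix at `(1, …, 1)` is nondegenerate. -/
theorem isStrongLefschetzElement_squarefreeSum [DecidableEq σ] [Fintype σ]
    {𝓑 : Finset (Finset σ)} {s : ℕ} (hs : 2 ≤ s)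
    (hs4 : s ≤ 4) (h𝓑 : 𝓑.Nonempty) (hcard : ∀ B ∈ 𝓑, B.card = s)
    (hess : ∀ v : σ → K, (∀ f, ∑ B ∈ 𝓑 with f ∈ B, ∑ e ∈ B.erase f, v e = 0) → v = 0) :
    IsStrongLefschetzElement (annQuotientPiece (squarefreeSum K 𝓑)) s
      (Ideal.Quotient.mk (annIdeal (squarefreeSum K 𝓑)) (∑ e, X e)) := by
  have hΦ := isHomogeneous_squarefreeSum (K := K) hcard
  have hL : Ideal.Quotient.mk (annIdeal (squarefreeSum K 𝓑)) (∑ e, X e) ∈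
      annQuotientPiece (squarefreeSum K 𝓑) 1 :=
    mem_annQuotientPiece.2 ⟨_, isHomogeneous_sum_X, rfl⟩
  refine ⟨hL, fun k hk => bijOn_pow_mul_of_injective hΦ hk hL fun a ha h => ?_⟩
  obtain ⟨P, hP, rfl⟩ := mem_annQuotientPiece.1 ha
  rw [← map_pow, ← map_mul, mk_eq_zero_iff_diffOp] at h
  rw [mk_eq_zero_iff_diffOp]
  obtain rfl | rfl | hk2 : k = 0 ∨ k = 1 ∨ s - 2 * k = 0 := by omega
  · obtain ⟨c, rfl⟩ := hP.exists_eq_C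
    rw [mul_comm, diffOp_mul_apply, diffOp_C_apply] at h
    have h1 := congrArg (eval fun _ => (1 : K)) h
    rw [smul_eval, mul_zero, Nat.sub_zero, hΦ.eval_one_diffOp_sum_X_pow, map_zero,
      eval_one_squarefreeSum] at h1
    have hc : c = 0 := by
      simpa [Nat.factorial_ne_zero, h𝓑.ne_empty] using h1
    simp [hc]
  · obtain ⟨v, rfl⟩ := exists_eq_linear_of_isHomogeneous_one hP
    have hv : v = 0 := hess v fun f => by
      -- Applying `∂_f` first leaves `L^(s-2)` acting on a form of degree `s - 2`, so evaluation
      -- yields `(s-2)!` times row `f` of the Hessian system.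
      have h1 := congrArg (fun F => eval (fun _ => (1 : K)) (pderiv f F)) h
      simp only [map_zero] at h1
      rw [← diffOp_X, ← diffOp_mul_apply, mul_comm, mul_assoc, diffOp_mul_apply,
        mul_one,
        IsHomogeneous.eval_one_diffOp_sum_X_pow (d := s - 2), diffOp_mul_apply, diffOp_X,
        eval_one_diffOp_linear_pderiv_squarefreeSum] at h1
      · exact (mul_eq_zero.1 h1).resolve_left (by exact_mod_cast Nat.factorial_ne_zero _)
      · exact (IsHomogeneous.mul hP (isHomogeneous_X K f)).diffOp hΦ
    simp [hv]
  · rwa [hk2, pow_zero, one_mul] at h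

end SquarefreeSum

/-! ### Hessians of the families of `r`-subsets of a grid, `r = 3, 4` -/

section GridFamily

variable {K : Type*} [Field K]

/-- Each `e ≠ f` shares with `f` the same number of `r`-sets, so the Hessian is a multiple of `J -
I`. -/
theorem sum_powersetCard_mem_sum_erase {σ : Type*} [Fintype σ] [DecidableEq σ] {r : ℕ}
    (hr : 2 ≤ r) (v : σ → K) (f : σ) :
    ∑ B ∈ Finset.univ.powersetCard r with f ∈ B, ∑ e ∈ B.erase f, v e =
      ((Fintype.card σ - 2).choose (r - 2) : ℕ) * (∑ e, v e - v f) := by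
  have h1 : ∀ B ∈ (Finset.univ.powersetCard r).filter fun B : Finset σ => f ∈ B,
      ∑ e ∈ B.erase f, v e = ∑ e ∈ Finset.univ.erase f, if e ∈ B then v e else 0 := by
    intro B _
    rw [← Finset.sum_filter]
    congr 1
    ext e
    simp
  rw [Finset.sum_congr rfl h1, Finset.sum_comm, ← Finset.sum_erase_eq_sub (Finset.mem_univ f),
    Finset.mul_sum]
  refine Finset.sum_congr rfl fun e he => ?_
  have hfe : f ≠ e := (Finset.ne_of_mem_erase he).symm
  rw [← Finset.sum_filter, Finset.sum_const, Finset.filter_filter, nsmul_eq_mul]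
  congr 2
  have := Finset.card_filter_powersetCard_subset {f, e} Finset.univ r (Finset.subset_univ _)
    (by rwa [Finset.card_pair hfe])
  rw [Finset.card_pair hfe, Finset.card_univ] at this
  rw [← this]
  congr 1
  ext B
  simp [Finset.insert_subset_iff]

theorem card_pair_product {α β : Type*} [DecidableEq α] [DecidableEq β] {i i' : α}
    {j j' : β} (hi : i ≠ i') (hj : j ≠ j') :
    (({i, i'} : Finset α) ×ˢ ({j, j'} : Finset β)).card = 4 := by
  rw [Finset.card_product, Finset.card_pair hi, Finset.card_pair hj]

theorem sum_pair_product_erase {α β : Type*} [DecidableEq α] [DecidableEq β]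
    (v : α × β → K) {i i' : α} {j j' : β} (hi : i ≠ i') (hj : j ≠ j') :
    ∑ e ∈ (({i, i'} : Finset α) ×ˢ ({j, j'} : Finset β)).erase (i, j), v e =
      v (i, j') + v (i', j) + v (i', j') := by
  rw [Finset.sum_erase_eq_sub (by simp), Finset.sum_product, Finset.sum_pair hi,
    Finset.sum_pair hj, Finset.sum_pair hj]
  ring

/-- The `r`-element sets of edges of `K_{α,β}` that contain no 4-cycle. -/
def rectangleFree (α β : Type*) [Fintype α] [Fintype β] [DecidableEq α] [DecidableEq β] (r : ℕ) :
    Finset (Finset (α × β)) :=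
  {B ∈ Finset.univ.powersetCard r | ¬ ∃ i i' j j', i ≠ i' ∧ j ≠ j' ∧
    ({i, i'} : Finset α) ×ˢ ({j, j'} : Finset β) ⊆ B}

variable {α β : Type*} [Fintype α] [Fintype β] [DecidableEq α] [DecidableEq β]

theorem rectangleFree_three : rectangleFree α β 3 = Finset.univ.powersetCard 3 := by
  refine Finset.filter_true_of_mem fun B hB => ?_
  rintro ⟨i, i', j, j', hi, hj, h⟩
  have := Finset.card_le_card h
  rw [card_pair_product hi hj, (Finset.mem_powersetCard.1 hB).2] at this
  omega

/-- A four-element set containing a rectangle equals it, and a rectangle through `(i, j)` is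
determined by its opposite corner `q`. -/
theorem sum_rectangles_mem_sum_erase (v : α × β → K) (i : α) (j : β) :
    ∑ B ∈ (Finset.univ.powersetCard 4).filter (fun B : Finset (α × β) => (i, j) ∈ B) with
        ∃ i i' j j', i ≠ i' ∧ j ≠ j' ∧ ({i, i'} : Finset α) ×ˢ ({j, j'} : Finset β) ⊆ B,
      ∑ e ∈ B.erase (i, j), v e =
    ∑ q ∈ Finset.univ.erase i ×ˢ Finset.univ.erase j,
      (v (i, q.2) + v (q.1, j) + v (q.1, q.2)) := by
  symm
  refine Finset.sum_bij (fun q _ => ({i, q.1} : Finset α) ×ˢ ({j, q.2} : Finset β)) ?_ ?_ ?_ ?_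
  · rintro ⟨i', j'⟩ h
    simp only [Finset.mem_product, Finset.mem_erase, Finset.mem_univ, and_true] at h
    simp only [Finset.mem_filter, Finset.mem_powersetCard, Finset.subset_univ, true_and]
    exact ⟨⟨card_pair_product h.1.symm h.2.symm, by simp⟩, i, i', j, j', h.1.symm, h.2.symm,
      subset_rfl⟩
  · rintro ⟨a, b⟩ h ⟨c, d⟩ h' heq
    simp only [Finset.mem_product, Finset.mem_erase, Finset.mem_univ, and_true] at h h'
    have h1 : (a, b) ∈ ({i, c} : Finset α) ×ˢ ({j, d} : Finset β) := heq ▸ (by simp)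
    simp only [Finset.mem_product, Finset.mem_insert, Finset.mem_singleton] at h1
    exact Prod.ext (h1.1.resolve_left h.1) (h1.2.resolve_left h.2)
  · intro B hB
    simp only [Finset.mem_filter, Finset.mem_powersetCard, Finset.subset_univ, true_and] at hB
    obtain ⟨⟨hc, hm⟩, a, a', b, b', ha, hb, hsub⟩ := hB
    have hB := Finset.eq_of_subset_of_card_le hsub (by rw [hc, card_pair_product ha hb])
    subst hB
    simp only [Finset.mem_product, Finset.mem_insert, Finset.mem_singleton] at hm
    -- The cases record which corner `(i, j)` is; the witness is always the opposite one.
    obtain ⟨rfl | rfl, rfl | rfl⟩ := hm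
    · exact ⟨(a', b'), by simp [ha.symm, hb.symm], rfl⟩
    · exact ⟨(a', b), by simp [ha.symm, hb], by rw [Finset.pair_comm j b]⟩
    · exact ⟨(a, b'), by simp [ha, hb.symm], by rw [Finset.pair_comm i a]⟩
    · exact ⟨(a, b), by simp [ha, hb], by rw [Finset.pair_comm i a, Finset.pair_comm j b]⟩
  · rintro ⟨i', j'⟩ h
    simp only [Finset.mem_product, Finset.mem_erase, Finset.mem_univ, and_true] at h
    exact (sum_pair_product_erase v h.1.symm h.2.symm).symm

theorem sum_erase_product_erase (v : α × β → K) (i : α) (j : β) :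
    ∑ q ∈ Finset.univ.erase i ×ˢ Finset.univ.erase j,
      (v (i, q.2) + v (q.1, j) + v (q.1, q.2)) =
    (Fintype.card α - 1) * (∑ b, v (i, b) - v (i, j)) +
      (Fintype.card β - 1) * (∑ a, v (a, j) - v (i, j)) +
      (∑ e, v e - ∑ b, v (i, b) - ∑ a, v (a, j) + v (i, j)) := by
  simp only [Finset.sum_add_distrib, Finset.sum_product, Finset.sum_const, nsmul_eq_mul,
    ← Finset.mul_sum, Finset.sum_erase_eq_sub (Finset.mem_univ _), Finset.sum_sub_distrib,
    Fintype.sum_prod_type, Finset.card_univ]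
  ring

theorem sum_rectangleFree_four (v : α × β → K) (i : α) (j : β) :
    ∑ B ∈ rectangleFree α β 4 with (i, j) ∈ B, ∑ e ∈ B.erase (i, j), v e =
      ((Fintype.card α * Fintype.card β - 2).choose 2 : ℕ) * (∑ e, v e - v (i, j)) -
      ((Fintype.card α - 1) * (∑ b, v (i, b) - v (i, j)) +
        (Fintype.card β - 1) * (∑ a, v (a, j) - v (i, j)) +
        (∑ e, v e - ∑ b, v (i, b) - ∑ a, v (a, j) + v (i, j))) := by
  rw [← Fintype.card_prod, ← sum_powersetCard_mem_sum_erase (by norm_num : 2 ≤ 4),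
    ← sum_erase_product_erase, ← sum_rectangles_mem_sum_erase, rectangleFree, eq_sub_iff_add_eq,
    Finset.filter_comm, add_comm]
  exact Finset.sum_filter_add_sum_filter_not _ _ _

variable [CharZero K]

/-- A kernel vector of `J - I` is constant, equal to its own sum `T`; then `T = N T` with `N ≠ 1`
the number of variables. -/
theorem eq_zero_of_uniform_hessian {σ : Type*} [Fintype σ] [DecidableEq σ] {r : ℕ} (hr : 2 ≤ r)
    (hσ : r ≤ Fintype.card σ) {v : σ → K}
    (h : ∀ f, ∑ B ∈ Finset.univ.powersetCard r with f ∈ B, ∑ e ∈ B.erase f, v e = 0) : v = 0 := by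
  have hc : (((Fintype.card σ - 2).choose (r - 2) : ℕ) : K) ≠ 0 :=
    Nat.cast_ne_zero.2 (Nat.choose_pos (by omega)).ne'
  have h1 : ∀ f, v f = ∑ e, v e := fun f => by
    have := h f
    rw [sum_powersetCard_mem_sum_erase hr] at this
    exact (sub_eq_zero.1 ((mul_eq_zero.1 this).resolve_left hc)).symm
  have h2 : ∑ e, v e = Fintype.card σ * ∑ e, v e := by
    conv_lhs => rw [Finset.sum_congr rfl fun f _ => h1 f]
    simp
  have h3 : ((Fintype.card σ : K) - 1) * ∑ e, v e = 0 := by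
    rw [sub_mul, ← h2, one_mul, sub_self]
  have h4 : ∑ e, v e = 0 := (mul_eq_zero.1 h3).resolve_left
    (sub_ne_zero.2 (by exact_mod_cast (by omega : Fintype.card σ ≠ 1)))
  exact funext fun f => (h1 f).trans h4

theorem intCast_ne_zero_of_pos {x : ℤ} (hx : 0 < x) {y : K} (hy : y = x) : y ≠ 0 := by
  rw [hy]
  exact_mod_cast hx.ne'

/-- Each equation involves only an entry, its row sum, its column sum and the total. Summing over
rows, columns or both isolates these quantities, each multiplied by an explicit integer polynomial
in `p = |α| - 1` that must not vanish. -/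
theorem eq_zero_of_rectangleFree_four_hessian (hα : 1 ≤ Fintype.card α)
    (hβ : Fintype.card β = 5) {v : α × β → K}
    (h : ∀ f, ∑ B ∈ rectangleFree α β 4 with f ∈ B, ∑ e ∈ B.erase f, v e = 0) : v = 0 := by
  obtain ⟨p, hp⟩ := Nat.exists_eq_add_of_le hα
  have hc : (((Fintype.card α * Fintype.card β - 2).choose 2 : ℕ) : K) =
      (5 * p + 3) * (5 * p + 2) / 2 := by
    rw [hp, hβ, show (1 + p) * 5 - 2 = 5 * p + 3 by omega, Nat.cast_choose_two]
    push_cast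
    ring
  -- The equations are doubled to clear the denominator of the binomial coefficient.
  have key : ∀ i j, (5 * p + 3) * (5 * p + 2) * (∑ e, v e - v (i, j)) -
      2 * (p * (∑ b, v (i, b) - v (i, j)) + 4 * (∑ a, v (a, j) - v (i, j)) +
        (∑ e, v e - ∑ b, v (i, b) - ∑ a, v (a, j) + v (i, j))) = 0 := fun i j => by
    have := h (i, j)
    rw [sum_rectangleFree_four, hc, hp, hβ] at this
    push_cast at this
    linear_combination 2 * this
  have hT' : ∑ e, v e = ∑ i, ∑ j, v (i, j) := Fintype.sum_prod_type _
  have hT'' : ∑ e, v e = ∑ j, ∑ i, v (i, j) := Fintype.sum_prod_type_right _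
  generalize hT : ∑ e, v e = T at key hT' hT''
  have hrow : ∀ i, (5 * p + 3) * (5 * p + 2) * (5 * T - ∑ b, v (i, b)) -
      2 * (p * (4 * ∑ b, v (i, b)) + 4 * (T - ∑ b, v (i, b)) +
        (5 * T - 5 * ∑ b, v (i, b) - T + ∑ b, v (i, b))) = 0 := fun i => by
    have := Finset.sum_eq_zero fun j (_ : j ∈ Finset.univ) => key i j
    simp only [Finset.sum_sub_distrib, Finset.sum_add_distrib, ← Finset.mul_sum, ← hT'',
      Finset.sum_const, Finset.card_univ, hβ, nsmul_eq_mul] at this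
    push_cast at this
    linear_combination this
  have hcol : ∀ j, (5 * p + 3) * (5 * p + 2) * ((1 + p) * T - ∑ a, v (a, j)) -
      2 * (p * (T - ∑ a, v (a, j)) + 4 * (p * ∑ a, v (a, j)) +
        ((1 + p) * T - T - (1 + p) * ∑ a, v (a, j) + ∑ a, v (a, j))) = 0 := fun j => by
    have := Finset.sum_eq_zero fun i (_ : i ∈ Finset.univ) => key i j
    simp only [Finset.sum_sub_distrib, Finset.sum_add_distrib, ← Finset.mul_sum, ← hT',
      Finset.sum_const, Finset.card_univ, hp, nsmul_eq_mul] at this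
    push_cast at this
    linear_combination this
  have hT0 : T = 0 := by
    have := Finset.sum_eq_zero fun j (_ : j ∈ Finset.univ) => hcol j
    simp only [Finset.sum_sub_distrib, Finset.sum_add_distrib, ← Finset.mul_sum, ← hT'',
      Finset.sum_const, Finset.card_univ, hβ, nsmul_eq_mul] at this
    push_cast at this
    have h0 : ((5 * p + 3) * (5 * p + 2) * (5 * p + 4) - 24 * p : K) * T = 0 := by
      linear_combination this
    refine (mul_eq_zero.1 h0).resolve_left (intCast_ne_zero_of_pos
      (x := (5 * p + 3) * (5 * p + 2) * (5 * p + 4) - 24 * p) ?_ (by push_cast; ring))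
    ring_nf
    positivity
  subst hT0
  have hR : ∀ i, ∑ b, v (i, b) = 0 := fun i => by
    have h0 : ((5 * p + 3) * (5 * p + 2) + 8 * (p - 2) : K) * ∑ b, v (i, b) = 0 := by
      linear_combination -hrow i
    refine (mul_eq_zero.1 h0).resolve_left ?_
    -- The coefficient is `-10` at `p = 0` and positive for `p ≥ 1`.
    rcases Nat.eq_zero_or_pos p with rfl | hp0
    · norm_num
    · refine intCast_ne_zero_of_pos (x := (5 * p + 3) * (5 * p + 2) + 8 * (p - 2)) ?_
        (by push_cast; ring)
      have : (1 : ℤ) ≤ p := by exact_mod_cast hp0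
      nlinarith
  have hS : ∀ j, ∑ a, v (a, j) = 0 := fun j => by
    have h0 : ((5 * p + 3) * (5 * p + 2) + 4 * p : K) * ∑ a, v (a, j) = 0 := by
      linear_combination -hcol j
    exact (mul_eq_zero.1 h0).resolve_left (intCast_ne_zero_of_pos
      (x := (5 * p + 3) * (5 * p + 2) + 4 * p) (by positivity) (by push_cast; ring))
  refine funext fun ⟨i, j⟩ => ?_
  -- The coefficient used for `p ≥ 1` vanishes at `p = 0`; there the grid has a single row, so each
  -- entry is its own column sum.
  rcases Nat.eq_zero_or_pos p with rfl | hp0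
  · have : Subsingleton α := Fintype.card_le_one_iff_subsingleton.1 hp.le
    have := hS j
    rwa [Fintype.sum_subsingleton _ i] at this
  · have h0 : ((5 * p + 3) * (5 * p + 2) - 2 * (p + 3) : K) * v (i, j) = 0 := by
      linear_combination -key i j - 2 * (p - 1 : K) * hR i - 6 * hS j
    refine (mul_eq_zero.1 h0).resolve_left (intCast_ne_zero_of_pos
      (x := (5 * p + 3) * (5 * p + 2) - 2 * (p + 3)) ?_ (by push_cast; ring))
    have : (1 : ℤ) ≤ p := by exact_mod_cast hp0
    nlinarith

end GridFamily

/-! ### Small forests of `K_{m,n}` as rectangle-free sets -/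

section CompleteBipartite

open SimpleGraph

variable {V W : Type*}

/-- The edge of `K_{V,W}` that joins `i` and `j`. -/
def bipartiteEdge (q : V × W) : Sym2 (V ⊕ W) :=
  s(Sum.inl q.1, Sum.inr q.2)

theorem bipartiteEdge_injective : Function.Injective (bipartiteEdge : V × W → Sym2 (V ⊕ W)) := by
  rintro ⟨a, b⟩ ⟨c, d⟩ h
  simpa [bipartiteEdge] using h

theorem range_bipartiteEdge :
    Set.range (bipartiteEdge : V × W → Sym2 (V ⊕ W)) = (completeBipartiteGraph V W).edgeSet := by
  ext e
  induction e with | h x y => ?_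
  rcases x with x | x <;> rcases y with y | y <;> simp [bipartiteEdge, Prod.exists]

theorem fromEdgeSet_bipartiteEdge_adj (I : Set (V × W)) (x y : V ⊕ W) :
    (fromEdgeSet (bipartiteEdge '' I)).Adj x y ↔
      Sum.elim (fun i => Sum.elim (fun _ => False) (fun j => (i, j) ∈ I) y)
        (fun j => Sum.elim (fun i => (i, j) ∈ I) (fun _ => False) y) x := by
  rcases x with x | x <;> rcases y with y | y <;> simp [bipartiteEdge]

/-- The edges of a cycle are distinct members of `I`, so its length is 3 or 4; bipartiteness
excludes 3, and the vertices of a 4-cycle give two distinct rows and two distinct columns. -/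
theorem exists_rectangle_of_isCycle [DecidableEq V] [DecidableEq W] {I : Finset (V × W)}
    (hI : I.card ≤ 4) {u : V ⊕ W}
    {w : (fromEdgeSet (bipartiteEdge '' (I : Set (V × W)))).Walk u u} (hw : w.IsCycle) :
    ∃ i i' j j', i ≠ i' ∧ j ≠ j' ∧ ({i, i'} : Finset V) ×ˢ ({j, j'} : Finset W) ⊆ I := by
  have hlen : w.length ≤ 4 := by
    rw [← w.length_edges, ← List.toFinset_card_of_nodup hw.edges_nodup]
    refine (Finset.card_le_card (t := I.image bipartiteEdge) fun e he => ?_).trans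
      (Finset.card_image_le.trans hI)
    have := w.edges_subset_edgeSet (List.mem_toFinset.1 he)
    rw [edgeSet_fromEdgeSet] at this
    simpa using this.1
  have hl := hw.three_le_length
  have key : ∀ {i i' j j'}, i ≠ i' → j ≠ j' → (i, j) ∈ I → (i, j') ∈ I → (i', j) ∈ I →
      (i', j') ∈ I →
      ∃ i i' j j', i ≠ i' ∧ j ≠ j' ∧ ({i, i'} : Finset V) ×ˢ ({j, j'} : Finset W) ⊆ I := by
    intro i i' j j' hi hj h1 h2 h3 h4
    refine ⟨i, i', j, j', hi, hj, fun q hq => ?_⟩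
    obtain ⟨a, b⟩ := q
    simp only [Finset.mem_product, Finset.mem_insert, Finset.mem_singleton] at hq
    obtain ⟨rfl | rfl, rfl | rfl⟩ := hq <;> assumption
  have hadj := fromEdgeSet_bipartiteEdge_adj (I : Set (V × W))
  rcases w with _ | ⟨h1, _ | ⟨h2, _ | ⟨h3, _ | ⟨h4, _ | ⟨h5, w⟩⟩⟩⟩⟩
  · simp at hl
  · simp at hl
  · simp at hl
  · rename_i a b
    rw [hadj] at h1 h2 h3
    rcases u with u | u <;> rcases a with a | a <;> rcases b with b | b <;> simp_all
  · rename_i a b c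
    have hn := hw.support_nodup
    rw [hadj] at h1 h2 h3 h4
    rcases u with u | u <;> rcases a with a | a <;> rcases b with b | b <;>
      rcases c with c | c <;> simp at h1 h2 h3 h4 hn
    -- Sides alternate along the cycle, so only the side of the starting vertex remains to be
    -- distinguished.
    · exact key (i := u) (i' := b) (j := a) (j' := c) (by tauto) (by tauto) h1 h4 h2 h3
    · exact key (i := a) (i' := c) (j := u) (j' := b) (by tauto) (by tauto) h1 h2 h4 h3
  · simp at hlen
    omega

theorem isAcyclic_bipartiteEdge_iff [DecidableEq V] [DecidableEq W] {I : Finset (V × W)}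
    (hI : I.card ≤ 4) :
    (fromEdgeSet (bipartiteEdge '' (I : Set (V × W)))).IsAcyclic ↔
      ¬ ∃ i i' j j', i ≠ i' ∧ j ≠ j' ∧ ({i, i'} : Finset V) ×ˢ ({j, j'} : Finset W) ⊆ I := by
  refine ⟨?_, fun h u w hw => h (exists_rectangle_of_isCycle hI hw)⟩
  rintro hac ⟨i, i', j, j', hi, hj, hsub⟩
  have hadj := fromEdgeSet_bipartiteEdge_adj (I : Set (V × W))
  have h1 : (fromEdgeSet (bipartiteEdge '' (I : Set (V × W)))).Adj (Sum.inl i) (Sum.inr j) :=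
    (hadj _ _).2 (hsub (by simp))
  have h2 : (fromEdgeSet (bipartiteEdge '' (I : Set (V × W)))).Adj (Sum.inr j) (Sum.inl i') :=
    (hadj _ _).2 (hsub (by simp))
  have h3 : (fromEdgeSet (bipartiteEdge '' (I : Set (V × W)))).Adj (Sum.inl i') (Sum.inr j') :=
    (hadj _ _).2 (hsub (by simp))
  have h4 : (fromEdgeSet (bipartiteEdge '' (I : Set (V × W)))).Adj (Sum.inr j') (Sum.inl i) :=
    (hadj _ _).2 (hsub (by simp))
  refine hac (Walk.cons h1 (Walk.cons h2 (Walk.cons h3 (Walk.cons h4 Walk.nil)))) ?_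
  rw [Walk.cons_isCycle_iff]
  simp [Walk.cons_isPath_iff, hi, hj, hi.symm]

theorem graphicMatroid_indep_iff {U : Type*} [Finite U] {G : SimpleGraph U} {I : Set (Sym2 U)} :
    (graphicMatroid G).Indep I ↔ I ⊆ G.edgeSet ∧ (fromEdgeSet I).IsAcyclic :=
  Iff.rfl

theorem graphicMatroid_completeBipartiteGraph_indep_iff [Finite V] [Finite W] [DecidableEq V]
    [DecidableEq W] {I : Finset (V × W)} (hI : I.card ≤ 4) :
    (graphicMatroid (completeBipartiteGraph V W)).Indep (bipartiteEdge '' (I : Set (V × W))) ↔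
      ¬ ∃ i i' j j', i ≠ i' ∧ j ≠ j' ∧ ({i, i'} : Finset V) ×ˢ ({j, j'} : Finset W) ⊆ I := by
  rw [graphicMatroid_indep_iff, isAcyclic_bipartiteEdge_iff hI, ← range_bipartiteEdge]
  exact and_iff_right (Set.image_subset_range _ _)

theorem card_of_mem_rectangleFree [Fintype V] [Fintype W] [DecidableEq V] [DecidableEq W] {r : ℕ}
    {B : Finset (V × W)} (hB : B ∈ rectangleFree V W r) : B.card = r :=
  (Finset.mem_powersetCard.1 (Finset.mem_filter.1 hB).1).2

theorem rectangleFree_nonempty [Fintype V] [Fintype W] [DecidableEq V] [DecidableEq W]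
    [Nonempty V] {r : ℕ} (hr : r ≤ Fintype.card W) : (rectangleFree V W r).Nonempty := by
  obtain ⟨i⟩ := ‹Nonempty V›
  obtain ⟨J, -, hJ⟩ := Finset.exists_subset_card_eq (s := (Finset.univ : Finset W)) hr
  -- A star with `r` edges at one vertex `i`.
  refine ⟨{i} ×ˢ J, Finset.mem_filter.2 ⟨Finset.mem_powersetCard.2 ⟨Finset.subset_univ _, ?_⟩, ?_⟩⟩
  · rw [Finset.card_product, Finset.card_singleton, one_mul, hJ]
  · rintro ⟨a, a', b, b', ha, -, hsub⟩
    have h1 := (Finset.mem_product.1 (hsub (x := (a, b)) (by simp))).1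
    have h2 := (Finset.mem_product.1 (hsub (x := (a', b)) (by simp))).1
    rw [Finset.mem_singleton] at h1 h2
    exact ha (h1.trans h2.symm)

theorem truncated_completeBipartiteGraph_isBase_iff [Fintype V] [Fintype W] [DecidableEq V]
    [DecidableEq W] [Nonempty V] {r : ℕ} (hr4 : r ≤ 4) (hr : r ≤ Fintype.card W)
    {I : Finset (V × W)} :
    (truncatedMatroid (graphicMatroid (completeBipartiteGraph V W)) r).IsBase
      (bipartiteEdge '' (I : Set (V × W))) ↔ I ∈ rectangleFree V W r := by
  have hcard : ∀ J : Finset (V × W), (bipartiteEdge '' (J : Set (V × W))).encard = J.card :=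
    fun J => by rw [bipartiteEdge_injective.encard_image, Set.encard_coe_eq_coe_finsetCard]
  -- A rectangle-free `r`-set is independent, so the truncation really has rank `r`.
  have hrank : (r : ℕ∞) ≤ (graphicMatroid (completeBipartiteGraph V W)).eRank := by
    obtain ⟨J, hJ⟩ := rectangleFree_nonempty (V := V) hr
    obtain ⟨hJc, hJr⟩ := Finset.mem_filter.1 hJ
    have hJc := (Finset.mem_powersetCard.1 hJc).2
    rw [← hJc, ← hcard]
    exact ((graphicMatroid_completeBipartiteGraph_indep_iff (hJc.trans_le hr4)).2
      hJr).encard_le_eRank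
  rw [truncatedMatroid_isBase_iff hrank, ← Matroid.indep_iff, hcard, Nat.cast_inj, rectangleFree,
    Finset.mem_filter, Finset.mem_powersetCard]
  simp only [Finset.subset_univ, true_and]
  exact and_congr_right fun h => graphicMatroid_completeBipartiteGraph_indep_iff (h.trans_le hr4)

/-- The ground set of the truncated graphic matroid of `K_{m,n}` is the set of pairs. -/
noncomputable def truncatedKmnGround (m n r : ℕ) : Fin m × Fin n ≃ (truncatedKmn m n r).E :=
  (Equiv.ofInjective _ bipartiteEdge_injective).trans (Equiv.setCongr range_bipartiteEdge)

end CompleteBipartite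

/-! ### Transport to the matroid's ground set and conclusion -/

open scoped Classical in
theorem basisGeneratingFunction_eq_squarefreeSum (K : Type*) [Field K] {α : Type*} [Finite α]
    (M : Matroid α) [Fintype M.E] :
    basisGeneratingFunction K M =
      squarefreeSum K
        (Finset.univ.filter fun B : Finset M.E => M.IsBase (Subtype.val '' (B : Set M.E))) := by
  rw [basisGeneratingFunction, squarefreeSum, eq_comm]
  -- The defining sum of `basisGeneratingFunction` is indexed by sets and `squarefreeSum` by
  -- finsets; coercion matches the two.
  refine Finset.sum_bij (fun B _ => (B : Set M.E)) (fun B hB => ?_)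
    (fun _ _ _ _ h => Finset.coe_injective h) (fun S hS => ?_) fun B _ => ?_
  · refine Finset.mem_filter.2 ⟨?_, (Finset.mem_filter.1 hB).2⟩
    simp [Finset.bind_def]
  · obtain ⟨-, hS⟩ := Finset.mem_filter.1 hS
    exact ⟨S.toFinset, Finset.mem_filter.2 ⟨Finset.mem_univ _, by rwa [Set.coe_toFinset]⟩,
      S.coe_toFinset⟩
  · exact Finset.prod_congr (by ext; simp) fun _ _ => rfl

theorem sumOfVariables_eq_mk (K : Type*) [Field K] {α : Type*} [Finite α]
    (M : Matroid α) [Fintype M.E] :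
    sumOfVariables K M = Ideal.Quotient.mk _ (∑ e, MvPolynomial.X e) := by
  rw [sumOfVariables, map_sum]
  congr!

open scoped Classical in
theorem truncatedKmn_bases_eq_map {m n r : ℕ} (hm : 1 ≤ m) (hr4 : r ≤ 4) (hrn : r ≤ n)
    [Fintype (truncatedKmn m n r).E] :
    (Finset.univ.filter fun B : Finset (truncatedKmn m n r).E =>
      (truncatedKmn m n r).IsBase (Subtype.val '' (B : Set (truncatedKmn m n r).E))) =
    (rectangleFree (Fin m) (Fin n) r).map (truncatedKmnGround m n r).finsetCongr.toEmbedding := by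
  have : Nonempty (Fin m) := ⟨⟨0, hm⟩⟩
  ext B
  obtain ⟨I, rfl⟩ := (truncatedKmnGround m n r).finsetCongr.surjective B
  rw [Finset.mem_filter, ← Equiv.coe_toEmbedding, Finset.mem_map', Equiv.coe_toEmbedding,
    ← truncated_completeBipartiteGraph_isBase_iff hr4 (by simpa using hrn),
    and_iff_right (Finset.mem_univ _), Equiv.finsetCongr_apply, Finset.coe_map, Set.image_image]
  rfl

theorem mainTheorem8 (K : Type*) [Field K] [CharZero K] (m n r : ℕ)
    (hm : 1 ≤ m) (hn : n ≤ 5) (hr : 2 < r) (hrn : r < n) :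
    HasStrongLefschetzProperty
        (annQuotientPiece (basisGeneratingFunction K (truncatedKmn m n r))) r ∧
      IsStrongLefschetzElement
        (annQuotientPiece (basisGeneratingFunction K (truncatedKmn m n r))) r
        (sumOfVariables K (truncatedKmn m n r)) := by
  classical
  let := Fintype.ofFinite (truncatedKmn m n r).E
  have : Nonempty (Fin m) := ⟨⟨0, hm⟩⟩
  set φ := truncatedKmnGround m n r
  have hne := rectangleFree_nonempty (V := Fin m) (W := Fin n) (r := r)
    (by simpa using hrn.le)
  have hhess : ∀ v : Fin m × Fin n → K,
      (∀ f, ∑ B ∈ rectangleFree (Fin m) (Fin n) r with f ∈ B, ∑ e ∈ B.erase f, v e = 0) →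
        v = 0 := fun v hv => by
    -- These are the only values allowed by `2 < r < n ≤ 5`.
    obtain rfl | ⟨rfl, rfl⟩ : r = 3 ∨ r = 4 ∧ n = 5 := by omega
    · rw [rectangleFree_three] at hv
      refine eq_zero_of_uniform_hessian (by norm_num) ?_ hv
      rw [Fintype.card_prod, Fintype.card_fin, Fintype.card_fin]
      nlinarith
    · exact eq_zero_of_rectangleFree_four_hessian (by simpa using hm) (by simp) hv
  have hcard : ∀ B ∈ (rectangleFree (Fin m) (Fin n) r).map φ.finsetCongr.toEmbedding,
      B.card = r := by
    intro B hB
    obtain ⟨I, hI, rfl⟩ := Finset.mem_map.1 hB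
    rw [Equiv.coe_toEmbedding, Equiv.finsetCongr_apply, Finset.card_map]
    exact card_of_mem_rectangleFree hI
  have hL : IsStrongLefschetzElement
      (annQuotientPiece (basisGeneratingFunction K (truncatedKmn m n r))) r
      (sumOfVariables K (truncatedKmn m n r)) := by
    rw [sumOfVariables_eq_mk, basisGeneratingFunction_eq_squarefreeSum,
      truncatedKmn_bases_eq_map hm (by omega) hrn.le]
    refine isStrongLefschetzElement_squarefreeSum hr.le (by omega) (hne.map) hcard fun v hv => ?_
    have h0 : v ∘ φ = 0 := hhess _ fun f => by
      have h1 := hv (φ f)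
      rw [Finset.filter_map, Finset.sum_map] at h1
      rw [← h1]
      refine Finset.sum_congr (Finset.filter_congr fun B _ => ?_) fun B _ => ?_
      · simp [φ]
      · rw [Equiv.coe_toEmbedding, Equiv.finsetCongr_apply, ← Equiv.coe_toEmbedding,
          ← Finset.map_erase, Finset.sum_map]
        rfl
    exact funext fun e => by simpa using congrFun h0 (φ.symm e)
  refine ⟨⟨?_, _, hL⟩, hL⟩
  rw [basisGeneratingFunction_eq_squarefreeSum, truncatedKmn_bases_eq_map hm (by omega) hrn.le]
  exact annQuotient_isGradedArtinian (isHomogeneous_squarefreeSum hcard)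
    (squarefreeSum_ne_zero hne.map)
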